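/- Work in $\mathbb{P}^3=\mathbb{P}^3_{\mathbb C}$ with homogeneous coordinates $x_0,x_1,x_2,x_3$. A quartic surface $S=\mathcal V(F)$ is a \emph{symmetroid} if its defining polynomial $F$ is, up to a nonzero constant, the determinant of a matrix $A_0x_0+A_1x_1+A_2x_2+A_3x_3$, where the $A_i$ are symmetric $4\times 4$ matrices over $\mathbb C$. For forms $A_d,B_d\in\mathbb C[x_1,x_2]$ of degree $d$ (possibly zero) consider the quartic form $$G = x_1^2x_0^2+2(x_1x_3A_1+A_3)x_0-x_1x_3^3+B_2x_3^2+B_3x_3+B_4. \qquad (*)$$ We say that a quartic form has the form $S^{(1)}_4$ (tacnodal form at $p=[1:0:0:0]$) if it equals $x_1^2x_0^2+(x_1F_2)x_0+F_4$ with $F_2,F_4\in\mathbb C[x_1,x_2,x_3]$ forms of degrees $2$ and $4$. A quartic surface is of Noether's type $S^{(3)}_4$ if, after a projective change of coordinates, it is given by an equation $(*)$ that does not have the form $S^{(1)}_4$ (equivalently, $x_1\nmid A_3$). \textbf{Proposition.} A quartic surface of type $S^{(3)}_4$ is not a symmetroid. In particular, no rational quartic surface of type $S^{(3)}_4$ is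 a symmetroid. Moreover, if $\mathcal V(G)$ with $G$ as in $(*)$ is a symmetroid, and $F_3=2(x_1x_3A_1+A_3)$, $F_4=-x_1x_3^3+B_2x_3^2+B_3x_3+B_4$, then the line $x_1=0$ is a component of the ramification sextic $F_3^2-4x_1^2F_4=0$ of the projection of $\mathcal V(G)$ from $p$, and $G$ has the tacnodal form $S^{(1)}_4$. -/

import Mathlib

open MvPolynomial

noncomputable section

/-- Polynomials in the homogeneous coordinates `x₀, x₁, x₂, x₃` of complex projective 3-space. -/
abbrev Poly4 : Type := MvPolynomial (Fin 4) ℂ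

/-- `P` is a form of degree `d` in the variables `xᵢ`, `i ∈ s`, only (the zero form is allowed). -/
def IsFormIn (s : Set (Fin 4)) (d : ℕ) (P : Poly4) : Prop :=
  P.IsHomogeneous d ∧ P ∈ MvPolynomial.supported ℂ s

/-- The matrix of linear forms `A(x) = A₀ x₀ + A₁ x₁ + A₂ x₂ + A₃ x₃`. -/
def linearMatrix (A : Fin 4 → Matrix (Fin 4) (Fin 4) ℂ) : Matrix (Fin 4) (Fin 4) Poly4 :=
  ∑ i, (X i : Poly4) • (A i).map (C : ℂ → Poly4)

/-- The quartic surface `V(F)` in projective 3-space is a symmetroid: its defining polynomial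
(which is determined by the surface up to a nonzero constant) can be written as the determinant
of a symmetric `4 × 4` matrix of linear forms. -/
def IsQuarticSymmetroid (F : Poly4) : Prop :=
  ∃ A : Fin 4 → Matrix (Fin 4) (Fin 4) ℂ, (∀ i, (A i).IsSymm) ∧
    ∃ c : ℂ, c ≠ 0 ∧ C c * F = (linearMatrix A).det

/-- The projective change of coordinates `xᵢ ↦ ∑ⱼ gᵢⱼ xⱼ`. -/
def changeCoords (g : GL (Fin 4) ℂ) (F : Poly4) : Poly4 :=
  aeval (fun i : Fin 4 => ∑ j : Fin 4, C ((g : Matrix (Fin 4) (Fin 4) ℂ) i j) * X j) F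

/-- `F₂ x₀² + F₃ x₀ + F₄`: the equation of a quartic surface with a double point
at `[1 : 0 : 0 : 0]` when `F₂, F₃, F₄` are forms of degrees 2, 3, 4 in `x₁, x₂, x₃`. -/
def doublePointQuartic (F₂ F₃ F₄ : Poly4) : Poly4 :=
  F₂ * X 0 ^ 2 + F₃ * X 0 + F₄

/-- The ramification sextic `F₃² - 4 F₂ F₄` of the projection of `V(F₂ x₀² + F₃ x₀ + F₄)`
from `[1 : 0 : 0 : 0]`. -/
def ramificationSextic (F₂ F₃ F₄ : Poly4) : Poly4 :=
  F₃ ^ 2 - 4 * F₂ * F₄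

/-- `G` has the form `x₁² x₀² + (x₁ F₂) x₀ + F₄` of a quartic with a tacnode
(a singularity of type `S⁽¹⁾₄`) at `[1 : 0 : 0 : 0]`, with `F₂, F₄` forms of degrees 2, 4
in `x₁, x₂, x₃`. -/
def HasFormS1 (G : Poly4) : Prop :=
  ∃ F₂ F₄ : Poly4, IsFormIn {1, 2, 3} 2 F₂ ∧ IsFormIn {1, 2, 3} 4 F₄ ∧
    G = doublePointQuartic (X 1 ^ 2) (X 1 * F₂) F₄

/-- The coefficient `2 (x₁ x₃ A₁ + A₃)` of `x₀` in the equation of type `S⁽³⁾₄`. -/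
def cubicS3 (A₁ A₃ : Poly4) : Poly4 :=
  2 * (X 1 * X 3 * A₁ + A₃)

/-- The part `- x₁ x₃³ + B₂ x₃² + B₃ x₃ + B₄` free of `x₀` in the equation of type `S⁽³⁾₄`. -/
def quarticS3 (B₂ B₃ B₄ : Poly4) : Poly4 :=
  -(X 1 * X 3 ^ 3) + B₂ * X 3 ^ 2 + B₃ * X 3 + B₄

/-- `x₁² x₀² + 2 (x₁ x₃ A₁ + A₃) x₀ - x₁ x₃³ + B₂ x₃² + B₃ x₃ + B₄`. -/
def equationS3 (A₁ A₃ B₂ B₃ B₄ : Poly4) : Poly4 :=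
  doublePointQuartic (X 1 ^ 2) (cubicS3 A₁ A₃) (quarticS3 B₂ B₃ B₄)

/-- `A₁, A₃, B₂, B₃, B₄` are admissible coefficients in the equation of type `S⁽³⁾₄`:
forms in `x₁, x₂` of the degrees given by their indices. -/
def AreCoeffsS3 (A₁ A₃ B₂ B₃ B₄ : Poly4) : Prop :=
  IsFormIn {1, 2} 1 A₁ ∧ IsFormIn {1, 2} 3 A₃ ∧
    IsFormIn {1, 2} 2 B₂ ∧ IsFormIn {1, 2} 3 B₃ ∧ IsFormIn {1, 2} 4 B₄

/-- The quartic surface `V(F)` is of Noether's type `S⁽³⁾₄`: in suitable coordinates it has,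
up to a nonzero constant, the equation `equationS3`, and its double point `[1 : 0 : 0 : 0]` is
not already of the tacnodal form `S⁽¹⁾₄`. The latter condition does not depend on the
coordinates: it says that the cubic coefficient of `x₀` does not vanish identically on the
reduced tangent cone `x₁ = 0`. -/
def IsTypeS3 (F : Poly4) : Prop :=
  ∃ g : GL (Fin 4) ℂ, ∃ c : ℂ, c ≠ 0 ∧ ∃ A₁ A₃ B₂ B₃ B₄ : Poly4,
    AreCoeffsS3 A₁ A₃ B₂ B₃ B₄ ∧
    C c * changeCoords g F = equationS3 A₁ A₃ B₂ B₃ B₄ ∧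
    ¬ HasFormS1 (equationS3 A₁ A₃ B₂ B₃ B₄)

end

/-! If the equation is a symmetric determinant, then on the plane `x₁ = 0` the coefficient of `x₀`
is, up to a constant, `2 a x₂³`, where `a` is the `x₂³`-coefficient of `A₃`. Everything reduces to
`a = 0` (`IsDoublePlanePencil.eq_zero`), which gives `x₁ ∣ A₃`.

The matrix at `p` is singular; congruence makes it diagonal, and the nonzero `x₀²`-coefficient `x₁²`
bounds its corank by two. That coefficient vanishes on `x₁ = 0`, which constrains the other
matrices. In corank one, the first row restricted to `x₁ = 0` is isotropic for a nondegenerate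
ternary form, hence a linear form times a fixed vector. The `x₀`-coefficient is then the square of
that linear form, which involves `x₃`, times another linear form, so it cannot be a nonzero multiple
of `x₂³`. In corank two, the kernel block is a pencil of `2 × 2` matrices of rank at most one with a
common kernel vector; `a ≠ 0` would force the first row of `A 3` to vanish. A vanishing first row is
excluded in both cases by the term `-x₁ x₃³`. -/

/-- The determinant of the pencil `x₀ A₀ + x₁ A₁ + x₂ A₂ + x₃ A₃` of symmetric matrices is, up to
a nonzero constant, a quartic `x₁² x₀² + g x₀ + h`, where `g` restricts to `2 a x₂³` on `x₁ = 0`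
and `h` restricts to `-x₁` modulo `x₁²` on the line `x₂ = 0`, `x₃ = 1`. -/
def IsDoublePlanePencil (A : Fin 4 → Matrix (Fin 4) (Fin 4) ℂ) (a : ℂ) : Prop :=
  (∀ i, (A i).IsSymm) ∧ ∃ c : ℂ, c ≠ 0 ∧ ∃ g h : ℂ → ℂ → ℂ → ℂ, ∃ b₂ b₃ b₄ : ℂ,
    (∀ x₀ x₁ x₂ x₃, (x₀ • A 0 + x₁ • A 1 + x₂ • A 2 + x₃ • A 3).det =
      c * (x₁ ^ 2 * x₀ ^ 2 + g x₁ x₂ x₃ * x₀ + h x₁ x₂ x₃)) ∧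
    (∀ x₂ x₃, g 0 x₂ x₃ = 2 * a * x₂ ^ 3) ∧
    (∀ x₁, h x₁ 0 1 = -x₁ + b₂ * x₁ ^ 2 + b₃ * x₁ ^ 3 + b₄ * x₁ ^ 4) ∧ h 0 0 0 = 0

/-! ### Invariance under congruence. -/

theorem IsDoublePlanePencil.congruence {A : Fin 4 → Matrix (Fin 4) (Fin 4) ℂ} {a : ℂ}
    (H : IsDoublePlanePencil A a) {P : Matrix (Fin 4) (Fin 4) ℂ} (hP : P.det ≠ 0) :
    IsDoublePlanePencil (fun i => P.transpose * A i * P) a := by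
  obtain ⟨hs, c, hc, g, h, b₂, b₃, b₄, hdet, hg, hh, h0⟩ := H
  refine ⟨fun i => ?_, c * P.det ^ 2, by positivity, g, h, b₂, b₃, b₄, fun x₀ x₁ x₂ x₃ => ?_,
    hg, hh, h0⟩
  · simp [Matrix.IsSymm, Matrix.transpose_mul, (hs i).eq, Matrix.mul_assoc]
  · have : x₀ • (P.transpose * A 0 * P) + x₁ • (P.transpose * A 1 * P)
        + x₂ • (P.transpose * A 2 * P) + x₃ • (P.transpose * A 3 * P)
        = P.transpose * (x₀ • A 0 + x₁ • A 1 + x₂ • A 2 + x₃ • A 3) * P := by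
      simp [Matrix.mul_add, Matrix.add_mul]
    rw [this, Matrix.det_mul, Matrix.det_mul, Matrix.det_transpose, hdet]
    ring

/-! ### Elementary algebra of small quadratic forms. -/

theorem Matrix.IsSymm.det_fin_four {R : Type*} [CommRing R] {M : Matrix (Fin 4) (Fin 4) R}
    (hM : M.IsSymm) :
    M.det = M 0 0 * (M 1 1 * (M 2 2 * M 3 3 - M 2 3 ^ 2) - M 1 2 * (M 1 2 * M 3 3 - M 2 3 * M 1 3)
        + M 1 3 * (M 1 2 * M 2 3 - M 2 2 * M 1 3))
      - M 0 1 ^ 2 * (M 2 2 * M 3 3 - M 2 3 ^ 2) - M 0 2 ^ 2 * (M 1 1 * M 3 3 - M 1 3 ^ 2)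
      - M 0 3 ^ 2 * (M 1 1 * M 2 2 - M 1 2 ^ 2)
      + 2 * M 0 1 * M 0 2 * (M 1 2 * M 3 3 - M 1 3 * M 2 3)
      + 2 * M 0 1 * M 0 3 * (M 1 3 * M 2 2 - M 1 2 * M 2 3)
      + 2 * M 0 2 * M 0 3 * (M 1 1 * M 2 3 - M 1 2 * M 1 3) := by
  rw [Matrix.det_succ_row_zero]
  simp only [Fin.sum_univ_four, Matrix.det_fin_three, Matrix.submatrix_apply]
  simp [Fin.succAbove, Fin.lt_def]
  rw [hM.apply 0 1, hM.apply 0 2, hM.apply 0 3, hM.apply 1 2, hM.apply 1 3, hM.apply 2 3]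
  ring

/-- A cubic polynomial function over `ℂ` that vanishes identically has zero coefficients. -/
theorem cubic_coeffs_eq_zero {p₀ p₁ p₂ p₃ : ℂ}
    (h : ∀ t : ℂ, p₃ * t ^ 3 + p₂ * t ^ 2 + p₁ * t + p₀ = 0) :
    p₀ = 0 ∧ p₁ = 0 ∧ p₂ = 0 ∧ p₃ = 0 := by
  have h0 := h 0
  have h1 := h 1
  have h2 := h (-1)
  have h3 := h 2
  refine ⟨?_, ?_, ?_, ?_⟩
  · linear_combination h0
  · linear_combination -h0 / 2 + h1 - h2 / 3 - h3 / 6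
  · linear_combination h1 / 2 + h2 / 2 - h0
  · linear_combination h0 / 2 - h1 / 2 - h2 / 6 + h3 / 6

/-- A pencil of symmetric `2 × 2` matrices of rank at most one has a common kernel vector. -/
theorem exists_common_kernel_of_rank_le_one {α β γ α' β' γ' : ℂ} (h : α * γ = β ^ 2)
    (h' : α' * γ' = β' ^ 2) (hm : α * γ' + α' * γ = 2 * β * β') :
    ∃ s t u v : ℂ, s * v - t * u ≠ 0 ∧ s * α + t * β = 0 ∧ s * β + t * γ = 0 ∧
      s * α' + t * β' = 0 ∧ s * β' + t * γ' = 0 := by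
  by_cases h1 : α = 0
  · have h2 : β = 0 := by simpa [h1] using h.symm
    by_cases h3 : γ = 0
    · by_cases h4 : α' = 0
      · have h5 : β' = 0 := by simpa [h4] using h'.symm
        exact ⟨1, 0, 0, 1, by simp, by simp [*], by simp [*], by simp [*], by simp [*]⟩
      · refine ⟨-β', α', 1, 0, by simpa using h4, by simp [*], by simp [*], by ring, ?_⟩
        linear_combination h'
    · have h4 : α' = 0 := by simpa [h1, h2, h3] using hm
      have h5 : β' = 0 := by simpa [h4] using h'.symm
      exact ⟨1, 0, 0, 1, by simp, by simp [*], by simp [*], by simp [*], by simp [*]⟩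
  -- The determinant vanishes on the whole pencil, so the first rows are proportional and `(-β, α)`
  -- kills both matrices.
  · have h3 : α * β' - α' * β = 0 := by
      have : (α * β' - α' * β) ^ 2 = 0 := by
        linear_combination (-α ^ 2) * h' + (α * α') * hm - α' ^ 2 * h
      simpa using this
    refine ⟨-β, α, 1, 0, by simpa using h1, by ring, by linear_combination h,
      by linear_combination h3, ?_⟩
    have : α * (-β * β' + α * γ') = 0 := by
      linear_combination α * hm - α' * h + β * h3
    simpa [h1] using this

/-- Two isotropic, mutually orthogonal vectors in a nondegenerate ternary quadratic space are
linearly dependent. -/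
theorem minors_eq_zero_of_isotropic {e₁ e₂ e₃ u₁ u₂ u₃ v₁ v₂ v₃ : ℂ} (h₁ : e₁ ≠ 0) (h₂ : e₂ ≠ 0)
    (h₃ : e₃ ≠ 0) (hu : e₁ * u₁ ^ 2 + e₂ * u₂ ^ 2 + e₃ * u₃ ^ 2 = 0)
    (hv : e₁ * v₁ ^ 2 + e₂ * v₂ ^ 2 + e₃ * v₃ ^ 2 = 0)
    (huv : e₁ * u₁ * v₁ + e₂ * u₂ * v₂ + e₃ * u₃ * v₃ = 0) :
    u₁ * v₂ = u₂ * v₁ ∧ u₁ * v₃ = u₃ * v₁ ∧ u₂ * v₃ = u₃ * v₂ := by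
  have k (e f g a b c a' b' c' : ℂ) (hf : f ≠ 0) (hg : g ≠ 0)
      (hu : e * a ^ 2 + f * b ^ 2 + g * c ^ 2 = 0)
      (hv : e * a' ^ 2 + f * b' ^ 2 + g * c' ^ 2 = 0)
      (huv : e * a * a' + f * b * b' + g * c * c' = 0) : b * c' = c * b' := by
    -- Lagrange's identity: this is the Gram determinant of the last two coordinates, which equals
    -- that of the first coordinate alone, namely zero.
    have : f * g * (b * c' - c * b') ^ 2 = 0 := by
      linear_combination (f * b' ^ 2 + g * c' ^ 2) * hu - e * a ^ 2 * hv
        + (e * a * a' - f * b * b' - g * c * c') * huv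
    simpa [hf, hg, sub_eq_zero] using this
  refine ⟨?_, ?_, ?_⟩
  · exact k e₃ e₁ e₂ u₃ u₁ u₂ v₃ v₁ v₂ h₁ h₂ (by linear_combination hu) (by linear_combination hv)
      (by linear_combination huv)
  · exact k e₂ e₁ e₃ u₂ u₁ u₃ v₂ v₁ v₃ h₁ h₃ (by linear_combination hu) (by linear_combination hv)
      (by linear_combination huv)
  · exact k e₁ e₂ e₃ u₁ u₂ u₃ v₁ v₂ v₃ h₂ h₃ hu hv huv

/-! ### Coefficients of the determinant in `x₀`. -/

/-- The principal minor of a symmetric matrix on the rows `i, j, k`. -/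
def symmMinor (N : Matrix (Fin 4) (Fin 4) ℂ) (i j k : Fin 4) : ℂ :=
  N i i * (N j j * N k k - N j k ^ 2) - N i j ^ 2 * N k k - N i k ^ 2 * N j j
    + 2 * N i j * N i k * N j k

/-- Each power of `t` collects products of diagonal entries times the complementary principal minors
of `N`. The zero diagonal entry removes `t ^ 4`, and the last conclusion is the absence of `t ^ 3`.
-/
theorem coeffs_det_diagonal_add {N : Matrix (Fin 4) (Fin 4) ℂ} (hN : N.IsSymm)
    {p q r c₀ c₁ c₂ : ℂ} (h : ∀ t : ℂ, (t • Matrix.diagonal ![0, p, q, r] + N).det =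
      c₂ * t ^ 2 + c₁ * t + c₀) :
    c₀ = N.det ∧
    c₁ = p * symmMinor N 0 2 3 + q * symmMinor N 0 1 3 + r * symmMinor N 0 1 2 ∧
    c₂ = p * q * (N 0 0 * N 3 3 - N 0 3 ^ 2) + p * r * (N 0 0 * N 2 2 - N 0 2 ^ 2)
      + q * r * (N 0 0 * N 1 1 - N 0 1 ^ 2) ∧
    p * q * r * N 0 0 = 0 := by
  have hd : ∀ t : ℂ, _ := fun t => by
    have hd := h t
    rw [(((Matrix.isSymm_diagonal _).smul t).add hN).det_fin_four] at hd
    simp at hd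
    exact hd
  rw [hN.det_fin_four]
  unfold symmMinor
  obtain ⟨k0, k1, k2, k3⟩ := cubic_coeffs_eq_zero
    (p₃ := p * q * r * N 0 0)
    (p₂ := p * q * (N 0 0 * N 3 3 - N 0 3 ^ 2) + p * r * (N 0 0 * N 2 2 - N 0 2 ^ 2)
      + q * r * (N 0 0 * N 1 1 - N 0 1 ^ 2) - c₂)
    (p₁ := p * symmMinor N 0 2 3 + q * symmMinor N 0 1 3 + r * symmMinor N 0 1 2 - c₁)
    (p₀ := N.det - c₀) (fun t => by
      rw [hN.det_fin_four]
      unfold symmMinor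
      linear_combination hd t)
  rw [hN.det_fin_four] at k0
  unfold symmMinor at k1
  exact ⟨by linear_combination -k0, by linear_combination -k1, by linear_combination -k2, k3⟩

/-- The matrix `x₁ A₁ + x₂ A₂ + x₃ A₃`. -/
def residualMatrix (A : Fin 4 → Matrix (Fin 4) (Fin 4) ℂ) (x₁ x₂ x₃ : ℂ) :
    Matrix (Fin 4) (Fin 4) ℂ :=
  x₁ • A 1 + x₂ • A 2 + x₃ • A 3

theorem residualMatrix_apply (A : Fin 4 → Matrix (Fin 4) (Fin 4) ℂ) (x₁ x₂ x₃ : ℂ) (i j : Fin 4) :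
    residualMatrix A x₁ x₂ x₃ i j = x₁ * A 1 i j + x₂ * A 2 i j + x₃ * A 3 i j := by
  simp [residualMatrix]

/-- The consequences for the residual matrix when the first matrix of the pencil is diagonal. -/
theorem IsDoublePlanePencil.residual {A : Fin 4 → Matrix (Fin 4) (Fin 4) ℂ} {a p q r : ℂ}
    (H : IsDoublePlanePencil A a) (h0 : A 0 = Matrix.diagonal ![0, p, q, r]) :
    ∃ c b₂ b₃ b₄ : ℂ, c ≠ 0 ∧
      (∀ x₁, (residualMatrix A x₁ 0 1).det =
        c * (-x₁ + b₂ * x₁ ^ 2 + b₃ * x₁ ^ 3 + b₄ * x₁ ^ 4)) ∧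
      (∀ x₂ x₃, p * symmMinor (residualMatrix A 0 x₂ x₃) 0 2 3
        + q * symmMinor (residualMatrix A 0 x₂ x₃) 0 1 3
        + r * symmMinor (residualMatrix A 0 x₂ x₃) 0 1 2 = c * (2 * a * x₂ ^ 3)) ∧
      (∀ x₁ x₂ x₃, ∀ N, N = residualMatrix A x₁ x₂ x₃ →
        p * q * (N 0 0 * N 3 3 - N 0 3 ^ 2) + p * r * (N 0 0 * N 2 2 - N 0 2 ^ 2)
          + q * r * (N 0 0 * N 1 1 - N 0 1 ^ 2) = c * x₁ ^ 2) ∧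
      (∀ x₁ x₂ x₃, p * q * r * residualMatrix A x₁ x₂ x₃ 0 0 = 0) := by
  obtain ⟨hs, c, hc, g, h, b₂, b₃, b₄, hdet, hg, hh, -⟩ := H
  have key : ∀ x₁ x₂ x₃, _ := fun x₁ x₂ x₃ =>
    coeffs_det_diagonal_add (N := residualMatrix A x₁ x₂ x₃) (p := p) (q := q) (r := r)
      (c₂ := c * x₁ ^ 2) (c₁ := c * g x₁ x₂ x₃) (c₀ := c * h x₁ x₂ x₃)
      ((((hs 1).smul x₁).add ((hs 2).smul x₂)).add ((hs 3).smul x₃)) (fun t => by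
        have := hdet t x₁ x₂ x₃
        rw [h0] at this
        rw [residualMatrix, ← add_assoc, ← add_assoc, this]
        ring)
  refine ⟨c, b₂, b₃, b₄, hc, fun x₁ => ?_, fun x₂ x₃ => ?_, ?_, fun x₁ x₂ x₃ => (key x₁ x₂ x₃).2.2.2⟩
  · rw [← hh, (key x₁ 0 1).1]
  · rw [← hg, (key 0 x₂ x₃).2.1]
  · rintro x₁ x₂ x₃ _ rfl
    exact (key x₁ x₂ x₃).2.2.1.symm

/-! ### The two possible coranks of `A 0`. -/

/-- The determinant cannot vanish to second order along the line `x₁ = x₂ = 0`. -/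
theorem IsDoublePlanePencil.not_first_row_eq_zero {A : Fin 4 → Matrix (Fin 4) (Fin 4) ℂ}
    {c b₂ b₃ b₄ : ℂ} (hs : ∀ i, (A i).IsSymm) (hc : c ≠ 0)
    (hdet : ∀ x₁, (residualMatrix A x₁ 0 1).det =
        c * (-x₁ + b₂ * x₁ ^ 2 + b₃ * x₁ ^ 3 + b₄ * x₁ ^ 4))
    (h00 : A 1 0 0 = 0) (h3 : ∀ j, A 3 0 j = 0) : False := by
  have hS : ∀ x, (residualMatrix A x 0 1).IsSymm := fun x =>
    (((hs 1).smul x).add ((hs 2).smul 0)).add ((hs 3).smul 1)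
  -- The first row and column are divisible by `x₁` and their common entry is zero, so the
  -- determinant is divisible by `x₁ ^ 2`.
  simp only [fun x => (hS x).det_fin_four, residualMatrix_apply, h00, h3, mul_zero, zero_mul,
    add_zero, zero_sub] at hdet
  apply hc
  -- The five-point difference formula extracts the linear coefficient of a quartic.
  linear_combination (2 / 3) * (hdet 1 - hdet (-1)) - (hdet 2 - hdet (-2)) / 12

/-- On `x₁ = 0` the `x₀`-coefficient is `-m r`, with `m = m₂ x₂ + m₃ x₃` the remaining entry of the
kernel block and `r = r₀ x₂² + r₁ x₂ x₃ + r₂ x₃²` a quadratic form evaluated on the rest of the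
first row. If it is a nonzero multiple of `x₂³`, neither factor involves `x₃`. -/
theorem IsDoublePlanePencil.eq_zero_of_corank_two_of_common_kernel
    {A : Fin 4 → Matrix (Fin 4) (Fin 4) ℂ} {a p q : ℂ} (H : IsDoublePlanePencil A a)
    (h0 : A 0 = Matrix.diagonal ![0, 0, p, q]) (h200 : A 2 0 0 = 0) (h201 : A 2 0 1 = 0)
    (h300 : A 3 0 0 = 0) (h301 : A 3 0 1 = 0) : a = 0 := by
  have hs := H.1
  obtain ⟨c, b₂, b₃, b₄, hc, hdet, hlin, hquad, -⟩ := H.residual h0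
  by_contra ha
  have hquad' : ∀ x₁ x₂ x₃, _ := fun x₁ x₂ x₃ => hquad x₁ x₂ x₃ _ rfl
  simp only [symmMinor, residualMatrix_apply, h200, h201, h300, h301, mul_zero, add_zero, zero_mul,
    zero_add, zero_sub, sub_zero, zero_pow two_ne_zero] at hlin hquad'
  have e1 := hquad' 1 0 0
  have e2 := hquad' 1 1 0
  have e3 := hquad' 1 0 1
  have f2 : p * q * A 1 0 0 * A 2 1 1 = 0 := by linear_combination e2 - e1
  have f3 : p * q * A 1 0 0 * A 3 1 1 = 0 := by linear_combination e3 - e1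
  have hpq : p * q ≠ 0 := by
    intro hpq
    apply hc
    linear_combination -e1 + (A 1 0 0 * A 1 1 1 - A 1 0 1 ^ 2) * hpq
  set m₂ := A 2 1 1
  set m₃ := A 3 1 1
  set r₀ := p * A 2 0 3 ^ 2 + q * A 2 0 2 ^ 2 with hr₀
  set r₁ := 2 * (p * A 2 0 3 * A 3 0 3 + q * A 2 0 2 * A 3 0 2) with hr₁
  set r₂ := p * A 3 0 3 ^ 2 + q * A 3 0 2 ^ 2 with hr₂
  have hcub : ∀ x₂, _ := fun x₂ : ℂ => hlin x₂ 1
  obtain ⟨k0, k1, k2, k3⟩ := cubic_coeffs_eq_zero (p₀ := m₃ * r₂) (p₁ := m₂ * r₂ + m₃ * r₁)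
    (p₂ := m₂ * r₁ + m₃ * r₀) (p₃ := m₂ * r₀ + c * (2 * a)) (fun t => by
      linear_combination -hcub t)
  have k3' : m₂ * r₀ ≠ 0 := by
    intro hk
    rw [hk, zero_add] at k3
    simp [hc, ha] at k3
  obtain ⟨hm₂, hr₀'⟩ := mul_ne_zero_iff.1 k3'
  have h100 : A 1 0 0 = 0 := by simpa [hpq, hm₂] using f2
  have hm₃ : m₃ = 0 := by
    by_contra hm₃
    have : r₂ = 0 := by simpa [hm₃] using k0
    have : r₁ = 0 := by simpa [hm₃, this] using k1
    exact hr₀' (by simpa [hm₃, this] using k2)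
  have hr₂' : r₂ = 0 := by simpa [hm₃, hm₂] using k1
  have hr₁' : r₁ = 0 := by simpa [hm₃, hm₂] using k2
  -- In a nondegenerate plane, an isotropic vector orthogonal to a nonisotropic one is zero.
  have h302 : A 3 0 2 = 0 := by
    have : q * r₀ * A 3 0 2 ^ 2 = 0 := by
      linear_combination p * A 2 0 3 ^ 2 * hr₂'
        + (q * A 2 0 2 * A 3 0 2 - p * A 2 0 3 * A 3 0 3) * hr₁' / 2
    have hq := right_ne_zero_of_mul hpq
    simpa [hq, hr₀'] using this
  have h303 : A 3 0 3 = 0 := by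
    have hp := left_ne_zero_of_mul hpq
    simpa [hr₂, h302, hp] using hr₂'
  refine IsDoublePlanePencil.not_first_row_eq_zero hs hc hdet h100 fun j => ?_
  fin_cases j
  exacts [h300, h301, h302, h303]

theorem IsDoublePlanePencil.eq_zero_of_corank_two
    {A : Fin 4 → Matrix (Fin 4) (Fin 4) ℂ} {a p q : ℂ} (H : IsDoublePlanePencil A a)
    (h0 : A 0 = Matrix.diagonal ![0, 0, p, q]) : a = 0 := by
  obtain ⟨c, b₂, b₃, b₄, hc, hdet, hlin, hquad, -⟩ := H.residual h0
  have hquad' : ∀ x₁ x₂ x₃, _ := fun x₁ x₂ x₃ => hquad x₁ x₂ x₃ _ rfl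
  simp only [residualMatrix_apply, zero_mul, zero_add] at hquad'
  have e1 := hquad' 1 0 0
  have e2 := hquad' 0 1 0
  have e3 := hquad' 0 0 1
  have e4 := hquad' 0 1 1
  -- This excludes corank three or more.
  have hpq : p * q ≠ 0 := by
    intro hpq
    apply hc
    rw [hpq] at e1
    linear_combination -e1
  obtain ⟨s, t, u, v, hdet', k1, k2, k3, k4⟩ := exists_common_kernel_of_rank_le_one
    (α := A 2 0 0) (β := A 2 0 1) (γ := A 2 1 1) (α' := A 3 0 0) (β' := A 3 0 1) (γ' := A 3 1 1)
    (mul_left_cancel₀ hpq (by linear_combination e2))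
    (mul_left_cancel₀ hpq (by linear_combination e3))
    (mul_left_cancel₀ hpq (by linear_combination e4 - e2 - e3))
  -- The change of basis moves the common kernel vector to first place and acts only on the kernel
  -- of `A 0`, leaving `A 0` unchanged.
  let P : Matrix (Fin 4) (Fin 4) ℂ := !![s, u, 0, 0; t, v, 0, 0; 0, 0, 1, 0; 0, 0, 0, 1]
  have hP : P.det ≠ 0 := by
    have : P.det = s * v - t * u := by
      simp [P, Matrix.det_succ_row_zero, Fin.sum_univ_succ, Fin.succAbove]
      ring
    rwa [this]
  have h10 : ∀ i, A i 1 0 = A i 0 1 := fun i => (H.1 i).apply 0 1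
  refine (H.congruence hP).eq_zero_of_corank_two_of_common_kernel (p := p) (q := q) ?_ ?_ ?_ ?_ ?_
  · ext i j
    fin_cases i <;> fin_cases j <;>
      simp [h0, P, Matrix.mul_apply, Fin.sum_univ_four, Matrix.diagonal_apply]
  · simp [P, Matrix.mul_apply, Fin.sum_univ_four, h10]
    linear_combination s * k1 + t * k2
  · simp [P, Matrix.mul_apply, Fin.sum_univ_four, h10]
    linear_combination u * k1 + v * k2
  · simp [P, Matrix.mul_apply, Fin.sum_univ_four, h10]
    linear_combination s * k3 + t * k4
  · simp [P, Matrix.mul_apply, Fin.sum_univ_four, h10]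
    linear_combination u * k3 + v * k4

theorem IsDoublePlanePencil.eq_zero_of_corank_one
    {A : Fin 4 → Matrix (Fin 4) (Fin 4) ℂ} {a p q r : ℂ} (H : IsDoublePlanePencil A a)
    (h0 : A 0 = Matrix.diagonal ![0, p, q, r]) (hp : p ≠ 0) (hq : q ≠ 0) (hr : r ≠ 0) :
    a = 0 := by
  have hs := H.1
  obtain ⟨c, b₂, b₃, b₄, hc, hdet, hlin, hquad, hcub⟩ := H.residual h0
  by_contra ha
  have hquad' : ∀ x₁ x₂ x₃, _ := fun x₁ x₂ x₃ => hquad x₁ x₂ x₃ _ rfl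
  simp only [residualMatrix_apply, mul_eq_zero, hp, hq, hr, false_or] at hcub
  have h100 : A 1 0 0 = 0 := by simpa using hcub 1 0 0
  have h200 : A 2 0 0 = 0 := by simpa using hcub 0 1 0
  have h300 : A 3 0 0 = 0 := by simpa using hcub 0 0 1
  simp only [symmMinor, residualMatrix_apply, h100, h200, h300, mul_zero, add_zero, zero_mul,
    zero_add, zero_sub] at hlin hquad'
  have e2 := hquad' 0 1 0
  have e3 := hquad' 0 0 1
  have e4 := hquad' 0 1 1
  obtain ⟨m₁, m₂, m₃⟩ := minors_eq_zero_of_isotropic (e₁ := q * r) (e₂ := p * r) (e₃ := p * q)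
    (u₁ := A 2 0 1) (u₂ := A 2 0 2) (u₃ := A 2 0 3) (v₁ := A 3 0 1) (v₂ := A 3 0 2) (v₃ := A 3 0 3)
    (by positivity) (by positivity) (by positivity) (by linear_combination -e2)
    (by linear_combination -e3) (by linear_combination (e2 + e3 - e4) / 2)
  -- On `x₁ = 0` the first row becomes `(τ x₂ + x₃)` times that of `A 3`.
  obtain ⟨τ, h1, h2, h3⟩ : ∃ τ, A 2 0 1 = τ * A 3 0 1 ∧ A 2 0 2 = τ * A 3 0 2 ∧
      A 2 0 3 = τ * A 3 0 3 := by
    by_cases n1 : A 3 0 1 = 0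
    · by_cases n2 : A 3 0 2 = 0
      · by_cases n3 : A 3 0 3 = 0
        · refine (IsDoublePlanePencil.not_first_row_eq_zero hs hc hdet h100 fun j => ?_).elim
          fin_cases j
          exacts [h300, n1, n2, n3]
        · exact ⟨A 2 0 3 / A 3 0 3, by field_simp; exact m₂, by field_simp; exact m₃, by field_simp⟩
      · exact ⟨A 2 0 2 / A 3 0 2, by field_simp; exact m₁, by field_simp,
          by field_simp; exact m₃.symm⟩
    · exact ⟨A 2 0 1 / A 3 0 1, by field_simp, by field_simp; exact m₁.symm,
        by field_simp; exact m₂.symm⟩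
  simp only [h1, h2, h3] at hlin
  set ρ : Fin 4 → ℂ := fun i =>
    p * (-A 3 0 2 ^ 2 * A i 3 3 - A 3 0 3 ^ 2 * A i 2 2 + 2 * A 3 0 2 * A 3 0 3 * A i 2 3)
    + q * (-A 3 0 1 ^ 2 * A i 3 3 - A 3 0 3 ^ 2 * A i 1 1 + 2 * A 3 0 1 * A 3 0 3 * A i 1 3)
    + r * (-A 3 0 1 ^ 2 * A i 2 2 - A 3 0 2 ^ 2 * A i 1 1 + 2 * A 3 0 1 * A 3 0 2 * A i 1 2) with hρ
  -- These are the coefficients of `(τ t + 1)² (ρ 2 t + ρ 3) - 2 a c t³`.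
  obtain ⟨k0, k1, k2, k3⟩ := cubic_coeffs_eq_zero (p₀ := ρ 3) (p₁ := ρ 2 + 2 * τ * ρ 3)
    (p₂ := τ ^ 2 * ρ 3 + 2 * τ * ρ 2) (p₃ := τ ^ 2 * ρ 2 - c * (2 * a)) (fun t => by
      linear_combination hlin t 1)
  have : ρ 2 = 0 := by simpa [k0] using k1
  rw [this] at k3
  simp [hc, ha] at k3

/-! ### Diagonalisation and the choice of corank. -/

/-- A complex symmetric matrix is congruent to a diagonal matrix. -/
theorem Matrix.IsSymm.exists_congruence_diagonal {n : ℕ} {M : Matrix (Fin n) (Fin n) ℂ}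
    (hM : M.IsSymm) : ∃ (P : Matrix (Fin n) (Fin n) ℂ) (d : Fin n → ℂ), P.det ≠ 0 ∧
      P.transpose * M * P = Matrix.diagonal d := by
  have hB : LinearMap.IsSymm (Matrix.toBilin' M) := by
    refine ⟨fun x y => ?_⟩
    simp only [Matrix.toBilin'_apply', RingHom.id_apply]
    rw [Matrix.dotProduct_mulVec, ← Matrix.mulVec_transpose, hM.eq, dotProduct_comm]
  obtain ⟨v, hv⟩ := LinearMap.BilinForm.exists_orthogonal_basis hB
  let w := v.reindex (finCongr (Module.finrank_fin_fun ℂ (n := n)))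
  have hw : ∀ i j, i ≠ j → w i ⬝ᵥ M.mulVec (w j) = 0 := fun i j hij => by
    have := hv (i := (finCongr (Module.finrank_fin_fun ℂ (n := n))).symm i)
      (j := (finCongr (Module.finrank_fin_fun ℂ (n := n))).symm j) (by simpa using hij)
    simpa [w, Matrix.toBilin'_apply'] using this
  refine ⟨(Pi.basisFun ℂ (Fin n)).toMatrix w, fun i => w i ⬝ᵥ M.mulVec (w i), ?_, ?_⟩
  · have := (Pi.basisFun ℂ (Fin n)).invertibleToMatrix w
    exact ((Matrix.isUnit_iff_isUnit_det _).1 (isUnit_of_invertible _)).ne_zero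
  · ext i j
    have : (((Pi.basisFun ℂ (Fin n)).toMatrix w).transpose * M *
        (Pi.basisFun ℂ (Fin n)).toMatrix w) i j = w i ⬝ᵥ M.mulVec (w j) := by
      rw [Matrix.mul_assoc, Matrix.mul_apply]
      simp [Matrix.mul_apply, dotProduct, Matrix.mulVec, Module.Basis.toMatrix_apply]
    rw [this, Matrix.diagonal_apply]
    split_ifs with h
    · rw [h]
    · exact hw i j h

theorem IsDoublePlanePencil.eq_zero {A : Fin 4 → Matrix (Fin 4) (Fin 4) ℂ} {a : ℂ}
    (H : IsDoublePlanePencil A a) : a = 0 := by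
  obtain ⟨P, d, hP, hd⟩ := (H.1 0).exists_congruence_diagonal
  have hdet : (A 0).det = 0 := by
    obtain ⟨-, c, -, g, h, -, -, -, hdet, hg, -, h0⟩ := H
    simpa [hg, h0] using hdet 1 0 0 0
  have perm : ∀ e : Equiv.Perm (Fin 4), ∃ A' : Fin 4 → Matrix (Fin 4) (Fin 4) ℂ,
      IsDoublePlanePencil A' a ∧ A' 0 = Matrix.diagonal (d ∘ e) := fun e => by
    refine ⟨_, H.congruence (P := P.submatrix id e) ?_, ?_⟩
    · rw [Matrix.det_permute']
      exact mul_ne_zero (by simp) hP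
    · have : (P.submatrix id e).transpose * A 0 * P.submatrix id e
          = (P.transpose * A 0 * P).submatrix e e := by
        ext i j
        simp [Matrix.mul_apply]
      simp only [this, hd]
      exact Matrix.submatrix_diagonal_equiv d e
  obtain ⟨i, -, hi⟩ : ∃ i ∈ Finset.univ, d i = 0 := by
    rw [← Finset.prod_eq_zero_iff, ← Matrix.det_diagonal, ← hd]
    simp [hdet]
  have vec : ∀ f : Fin 4 → ℂ, f = ![f 0, f 1, f 2, f 3] := fun f => by
    ext k; fin_cases k <;> rfl
  by_cases hj : ∃ j, j ≠ i ∧ d j = 0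
  · obtain ⟨j, hji, hj⟩ := hj
    let k := Equiv.swap 0 i j
    have hk : k ≠ 0 := fun hk => hji <| by
      have := congrArg (Equiv.swap 0 i) hk
      simpa [k] using this
    -- Here `k` is where the second zero sits once the first has been swapped into position `0`.
    obtain ⟨A', H', h0⟩ := perm (Equiv.swap 0 i * Equiv.swap 1 k)
    have e0 : (d ∘ (Equiv.swap 0 i * Equiv.swap 1 k : Equiv.Perm (Fin 4))) 0 = 0 := by
      simp [Equiv.swap_apply_of_ne_of_ne (zero_ne_one) hk.symm, hi]
    have e1 : (d ∘ (Equiv.swap 0 i * Equiv.swap 1 k : Equiv.Perm (Fin 4))) 1 = 0 := by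
      simp [k, hj]
    rw [vec (d ∘ _), e0, e1] at h0
    exact H'.eq_zero_of_corank_two h0
  · push Not at hj
    obtain ⟨A', H', h0⟩ := perm (Equiv.swap 0 i)
    have hne : ∀ k, k ≠ 0 → (d ∘ Equiv.swap 0 i) k ≠ 0 := fun k hk => hj _ fun h => hk <| by
      have := congrArg (Equiv.swap 0 i) h
      simpa using this
    rw [vec (d ∘ _), show (d ∘ Equiv.swap 0 i) 0 = 0 by simp [hi]] at h0
    exact H'.eq_zero_of_corank_one h0 (hne 1 (by decide)) (hne 2 (by decide)) (hne 3 (by decide))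

/-! ### From polynomials to pencils. -/

/-- Coordinates outside `s` are unconstrained, so `t = 1` also expresses independence of them. -/
theorem IsFormIn.eval_eq_pow_mul {s : Set (Fin 4)} {d : ℕ} {P : Poly4} (hP : IsFormIn s d P)
    {x y : Fin 4 → ℂ} {t : ℂ} (hxy : ∀ i ∈ s, y i = t * x i) : eval y P = t ^ d * eval x P := by
  rw [eval_eq', eval_eq', Finset.mul_sum]
  refine Finset.sum_congr rfl fun m hm => ?_
  have hdeg : ∑ i, m i = d := by
    rw [← hP.1 (mem_support_iff.1 hm)]
    simp [Finsupp.weight_apply, Finsupp.sum_fintype]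
  rw [← hdeg, ← Finset.prod_pow_eq_pow_sum, mul_left_comm, ← Finset.prod_mul_distrib]
  congr 1
  refine Finset.prod_congr rfl fun i _ => ?_
  by_cases hi : i ∈ s
  · rw [hxy i hi, mul_pow]
  · have : m i = 0 := by
      by_contra h
      exact hi (mem_supported.1 hP.2 ((mem_vars_iff_mem_support i).2 ⟨m, hm, Finsupp.mem_support_iff.2 h⟩))
    simp [this]

/-- A binary form in `x₁, x₂` is a multiple of `x₁` up to its pure power of `x₂`. -/
theorem IsFormIn.exists_eq_X_mul_add {d : ℕ} {P : Poly4} (hP : IsFormIn {1, 2} (d + 1) P) :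
    ∃ Q : Poly4, ∃ a : ℂ, IsFormIn {1, 2} d Q ∧ P = X 1 * Q + C a * X 2 ^ (d + 1) := by
  rw [P.as_sum]
  refine Finset.sum_induction _ (fun R => ∃ Q : Poly4, ∃ a : ℂ, IsFormIn {1, 2} d Q ∧
    R = X 1 * Q + C a * X 2 ^ (d + 1)) ?_ ?_ fun m hm => ?_
  · rintro _ _ ⟨Q, a, hQ, rfl⟩ ⟨Q', a', hQ', rfl⟩
    exact ⟨Q + Q', a + a', ⟨hQ.1.add hQ'.1, add_mem hQ.2 hQ'.2⟩, by rw [C_add]; ring⟩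
  · exact ⟨0, 0, ⟨isHomogeneous_zero _ _ _, zero_mem _⟩, by simp⟩
  have hdeg : m.degree = d + 1 := by
    rw [← hP.1 (mem_support_iff.1 hm), Finsupp.degree_eq_weight_one]
    rfl
  have hsupp : ∀ i, m i ≠ 0 → i = 1 ∨ i = 2 := fun i hi => by
    simpa using mem_supported.1 hP.2
      ((mem_vars_iff_mem_support i).2 ⟨m, hm, Finsupp.mem_support_iff.2 hi⟩)
  by_cases h1 : m 1 = 0
  · have hm2 : m = Finsupp.single 2 (m 2) := by
      ext i
      by_cases hi : i = 2
      · simp [hi]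
      · rw [Finsupp.single_eq_of_ne hi]
        by_contra h
        rcases hsupp i h with rfl | rfl
        exacts [h h1, hi rfl]
    have h2 : m 2 = d + 1 := by
      rw [hm2] at hdeg
      simpa using hdeg
    rw [h2] at hm2
    refine ⟨0, coeff m P, ⟨isHomogeneous_zero _ _ _, zero_mem _⟩, ?_⟩
    rw [C_mul_X_pow_eq_monomial, ← hm2, mul_zero, zero_add]
  · have hle : Finsupp.single 1 1 ≤ m := by
      simpa [Finsupp.single_le_iff, Nat.one_le_iff_ne_zero] using h1
    have hm' : m = Finsupp.single 1 1 + (m - Finsupp.single 1 1) :=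
      (add_tsub_cancel_of_le hle).symm
    refine ⟨monomial (m - Finsupp.single 1 1) (coeff m P), 0, ⟨isHomogeneous_monomial _ ?_, ?_⟩, ?_⟩
    · rw [hm', map_add, Finsupp.degree_single] at hdeg
      omega
    · refine mem_supported.2 fun i hi => ?_
      obtain ⟨k, hk, hik⟩ := (mem_vars_iff_mem_support i).1 hi
      have : k = m - Finsupp.single 1 1 := by
        simpa using support_monomial_subset hk
      subst this
      refine hsupp i fun h => Finsupp.mem_support_iff.1 hik ?_
      simp [h]
    · rw [X, monomial_mul, one_mul, ← hm', C_0, zero_mul, add_zero]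

theorem IsFormIn.exists_eq_X_mul {d : ℕ} {P : Poly4} (hP : IsFormIn {1, 2} (d + 1) P)
    (h : eval ![0, 0, 1, 0] P = 0) : ∃ Q : Poly4, IsFormIn {1, 2} d Q ∧ P = X 1 * Q := by
  obtain ⟨Q, a, hQ, rfl⟩ := hP.exists_eq_X_mul_add
  have : a = 0 := by simpa using h
  exact ⟨Q, hQ, by simp [this]⟩

theorem eval_det_linearMatrix (A : Fin 4 → Matrix (Fin 4) (Fin 4) ℂ) (x : Fin 4 → ℂ) :
    eval x (linearMatrix A).det = (x 0 • A 0 + x 1 • A 1 + x 2 • A 2 + x 3 • A 3).det := by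
  rw [RingHom.map_det]
  congr 1
  ext i j
  simp [linearMatrix, Fin.sum_univ_four]

theorem AreCoeffsS3.isDoublePlanePencil {A₁ A₃ B₂ B₃ B₄ : Poly4}
    (h : AreCoeffsS3 A₁ A₃ B₂ B₃ B₄) {A : Fin 4 → Matrix (Fin 4) (Fin 4) ℂ}
    (hA : ∀ i, (A i).IsSymm) {c : ℂ} (hc : c ≠ 0)
    (hdet : C c * equationS3 A₁ A₃ B₂ B₃ B₄ = (linearMatrix A).det) :
    IsDoublePlanePencil A (eval ![0, 0, 1, 0] A₃) := by
  obtain ⟨h₁, h₃, k₂, k₃, k₄⟩ := h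
  have indep : ∀ {d : ℕ} {P : Poly4}, IsFormIn {1, 2} d P → ∀ x₀ x₁ x₂ x₃ : ℂ,
      eval ![x₀, x₁, x₂, x₃] P = eval ![0, x₁, x₂, x₃] P := fun hP x₀ x₁ x₂ x₃ => by
    rw [hP.eval_eq_pow_mul (x := ![0, x₁, x₂, x₃]) (t := 1) (by simp), one_pow, one_mul]
  have line : ∀ {d : ℕ} {P : Poly4}, IsFormIn {1, 2} d P → ∀ x₁ x₃ : ℂ,
      eval ![0, x₁, 0, x₃] P = x₁ ^ d * eval ![0, 1, 0, 0] P := fun hP x₁ x₃ =>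
    hP.eval_eq_pow_mul (by simp)
  refine ⟨hA, c, hc, fun x₁ x₂ x₃ => eval ![0, x₁, x₂, x₃] (cubicS3 A₁ A₃),
    fun x₁ x₂ x₃ => eval ![0, x₁, x₂, x₃] (quarticS3 B₂ B₃ B₄), eval ![0, 1, 0, 0] B₂,
    eval ![0, 1, 0, 0] B₃, eval ![0, 1, 0, 0] B₄, fun x₀ x₁ x₂ x₃ => ?_, fun x₂ x₃ => ?_,
    fun x₁ => ?_, ?_⟩
  · have := congrArg (eval ![x₀, x₁, x₂, x₃]) hdet
    rw [eval_det_linearMatrix] at this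
    simp only [equationS3, doublePointQuartic, cubicS3, quarticS3, map_mul, map_add, map_neg,
      map_pow, eval_C, eval_X, indep h₁ x₀, indep h₃ x₀, indep k₂ x₀, indep k₃ x₀,
      indep k₄ x₀] at this
    simp at this
    rw [← this]
    simp [cubicS3, quarticS3]
  · have := h₃.eval_eq_pow_mul (x := ![0, 0, 1, 0]) (y := ![0, 0, x₂, x₃]) (t := x₂) (by simp)
    simp [cubicS3, this]
    ring
  · simp only [quarticS3, map_add, map_mul, map_neg, map_pow, eval_X]
    rw [line k₂ x₁ 1, line k₃ x₁ 1, line k₄ x₁ 1]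
    simp
    ring
  · simp only [quarticS3, map_add, map_mul, map_neg, map_pow, eval_X]
    rw [line k₂ 0 0, line k₃ 0 0, line k₄ 0 0]
    simp

theorem AreCoeffsS3.exists_eq_X_mul_of_symmetroid {A₁ A₃ B₂ B₃ B₄ : Poly4}
    (h : AreCoeffsS3 A₁ A₃ B₂ B₃ B₄)
    (hS : IsQuarticSymmetroid (equationS3 A₁ A₃ B₂ B₃ B₄)) :
    ∃ Q : Poly4, IsFormIn {1, 2} 2 Q ∧ A₃ = X 1 * Q := by
  obtain ⟨A, hA, c, hc, hdet⟩ := hS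
  exact h.2.1.exists_eq_X_mul (h.isDoublePlanePencil hA hc hdet).eq_zero

/-! ### The tacnodal form and changes of coordinates. -/

theorem isFormIn_X {s : Set (Fin 4)} {i : Fin 4} (hi : i ∈ s) : IsFormIn s 1 (X i) :=
  ⟨isHomogeneous_X _ _, X_mem_supported.2 hi⟩

theorem IsFormIn.mono {s t : Set (Fin 4)} {d : ℕ} {P : Poly4} (hP : IsFormIn s d P)
    (hst : s ⊆ t) : IsFormIn t d P :=
  ⟨hP.1, supported_mono hst hP.2⟩

theorem IsFormIn.add {s : Set (Fin 4)} {d : ℕ} {P Q : Poly4} (hP : IsFormIn s d P)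
    (hQ : IsFormIn s d Q) : IsFormIn s d (P + Q) :=
  ⟨hP.1.add hQ.1, add_mem hP.2 hQ.2⟩

theorem IsFormIn.neg {s : Set (Fin 4)} {d : ℕ} {P : Poly4} (hP : IsFormIn s d P) :
    IsFormIn s d (-P) :=
  ⟨hP.1.neg, neg_mem hP.2⟩

theorem IsFormIn.mul {s : Set (Fin 4)} {d e : ℕ} {P Q : Poly4} (hP : IsFormIn s d P)
    (hQ : IsFormIn s e Q) : IsFormIn s (d + e) (P * Q) :=
  ⟨hP.1.mul hQ.1, mul_mem hP.2 hQ.2⟩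

theorem IsFormIn.pow {s : Set (Fin 4)} {d : ℕ} {P : Poly4} (hP : IsFormIn s d P) (n : ℕ) :
    IsFormIn s (d * n) (P ^ n) :=
  ⟨hP.1.pow n, pow_mem hP.2 n⟩

theorem AreCoeffsS3.hasFormS1 {A₁ Q B₂ B₃ B₄ : Poly4}
    (h : AreCoeffsS3 A₁ (X 1 * Q) B₂ B₃ B₄) (hQ : IsFormIn {1, 2} 2 Q) :
    HasFormS1 (equationS3 A₁ (X 1 * Q) B₂ B₃ B₄) := by
  obtain ⟨h₁, -, k₂, k₃, k₄⟩ := h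
  have hsub : ({1, 2} : Set (Fin 4)) ⊆ {1, 2, 3} := by
    intro i
    simp only [Set.mem_insert_iff, Set.mem_singleton_iff]
    tauto
  have hX₁ : IsFormIn {1, 2, 3} 1 (X 1) := isFormIn_X (by simp)
  have hX₃ : IsFormIn {1, 2, 3} 1 (X 3) := isFormIn_X (by simp)
  have hR := (hX₃.mul (h₁.mono hsub)).add (hQ.mono hsub)
  refine ⟨(X 3 * A₁ + Q) + (X 3 * A₁ + Q), quarticS3 B₂ B₃ B₄, hR.add hR, ?_, ?_⟩
  · exact (((hX₁.mul (hX₃.pow 3)).neg.add ((k₂.mono hsub).mul (hX₃.pow 2))).add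
      ((k₃.mono hsub).mul hX₃)).add (k₄.mono hsub)
  · unfold equationS3 doublePointQuartic cubicS3
    ring

/-- Substitution replaces the `A i` by linear combinations of them, which preserves symmetry. -/
theorem changeCoords_linearMatrix_det (g : GL (Fin 4) ℂ)
    (A : Fin 4 → Matrix (Fin 4) (Fin 4) ℂ) :
    changeCoords g (linearMatrix A).det =
      (linearMatrix fun j => ∑ i, (g : Matrix (Fin 4) (Fin 4) ℂ) i j • A i).det := by
  unfold changeCoords
  rw [AlgHom.map_det]
  congr 1
  ext1 k l
  simp only [linearMatrix, AlgHom.mapMatrix_apply, Matrix.map_apply, Matrix.sum_apply,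
    Matrix.smul_apply, smul_eq_mul, map_sum, map_mul, aeval_X, aeval_C, algebraMap_eq,
    Finset.sum_mul, Finset.mul_sum]
  rw [Finset.sum_comm]
  exact Finset.sum_congr rfl fun _ _ => Finset.sum_congr rfl fun _ _ => by ring

theorem IsQuarticSymmetroid.changeCoords {F : Poly4} (hF : IsQuarticSymmetroid F)
    (g : GL (Fin 4) ℂ) : IsQuarticSymmetroid (changeCoords g F) := by
  obtain ⟨A, hA, c, hc, hdet⟩ := hF
  refine ⟨fun j => ∑ i, (g : Matrix (Fin 4) (Fin 4) ℂ) i j • A i, fun j => ?_, c, hc, ?_⟩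
  · simp [Matrix.IsSymm, Matrix.transpose_sum, fun i => (hA i).eq]
  · rw [← changeCoords_linearMatrix_det, ← hdet]
    simp [_root_.changeCoords]

theorem IsQuarticSymmetroid.C_mul {F : Poly4} (hF : IsQuarticSymmetroid F) {c : ℂ} (hc : c ≠ 0) :
    IsQuarticSymmetroid (C c * F) := by
  obtain ⟨A, hA, b, hb, hdet⟩ := hF
  refine ⟨A, hA, b / c, div_ne_zero hb hc, ?_⟩
  rw [← hdet, ← mul_assoc, ← map_mul, div_mul_cancel₀ b hc]

theorem mainTheorem5 :
    (∀ F : Poly4, IsTypeS3 F → ¬ IsQuarticSymmetroid F) ∧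
    (∀ A₁ A₃ B₂ B₃ B₄ : Poly4, AreCoeffsS3 A₁ A₃ B₂ B₃ B₄ →
      IsQuarticSymmetroid (equationS3 A₁ A₃ B₂ B₃ B₄) →
        MvPolynomial.X 1 ∣
          ramificationSextic (MvPolynomial.X 1 ^ 2) (cubicS3 A₁ A₃) (quarticS3 B₂ B₃ B₄) ∧
        HasFormS1 (equationS3 A₁ A₃ B₂ B₃ B₄)) := by
  refine ⟨?_, fun A₁ A₃ B₂ B₃ B₄ h hS => ?_⟩
  · rintro F ⟨g, c, hc, A₁, A₃, B₂, B₃, B₄, h, hF, hnot⟩ hS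
    have hG := (hS.changeCoords g).C_mul hc
    rw [hF] at hG
    obtain ⟨Q, hQ, rfl⟩ := h.exists_eq_X_mul_of_symmetroid hG
    exact hnot (h.hasFormS1 hQ)
  · obtain ⟨Q, hQ, rfl⟩ := h.exists_eq_X_mul_of_symmetroid hS
    refine ⟨?_, h.hasFormS1 hQ⟩
    -- With `x₁ ∣ A₃` the cubic is divisible by `x₁`, so the sextic is even divisible by `x₁²`.
    refine ⟨4 * X 1 * (X 3 * A₁ + Q) ^ 2 - 4 * X 1 * quarticS3 B₂ B₃ B₄, ?_⟩
    unfold ramificationSextic cubicS3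
    ring
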